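/- Let $\lambda$ denote Lebesgue measure, on $[0,1]$ and on $\mathbb{R}^d$ (for $d=0$, $[0,1]^0=\mathbb{R}^0$ is a point of mass $1$). Let $d,D\ge 0$ be integers and let $\mathbb{P}$ be a Borel probability measure on $\mathbb{R}^D$. Suppose that $\mathbb{P}(K)=1$ for some compact set $K\subset\mathbb{R}^D$, and that there are a constant $C_f>0$ and a Lipschitz homeomorphism $f$ from $[0,1]^d$ onto $K$ such that $\mathbb{P}(f(B))\ge C_f\,\lambda(B)$ for every Borel set $B\subset[0,1]^d$; suppose moreover that, if $d>0$, the push-forward $(f^{-1})_\#\mathbb{P}$ vanishes on the boundary of the cube, i.e. $\mathbb{P}(f(\partial[0,1]^d))=0$. Then there exists a continuous curve $\gamma:[0,1]\to\operatorname{supp}(\mathbb{P})$ such that $\gamma_\#\lambda=\mathbb{P}$. Furthermore, if $d\ge 1$, this $\gamma$ can be chosen $1/d$-Hölder continuous, i.e. $\|\gamma(s)-\gamma(t)\|\le C|s-t|^{1/d}$ for all $s,t\in[0,1]$ and some constant $C$. -/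

import Mathlib

open MeasureTheory
open scoped NNReal ENNReal

/-- The unit cube `[0,1]^d` as a subset of Euclidean space `ℝ^d`. -/
def unitCube (d : ℕ) : Set (EuclideanSpace ℝ (Fin d)) :=
  {x | ∀ i, x i ∈ Set.Icc (0 : ℝ) 1}

/-- `f(B) ⊆ ℝ^D` for a homeomorphism `f` from `[0,1]^d` onto `K ⊆ ℝ^D` and a set `B ⊆ ℝ^d`;
only the part of `B` inside the cube matters. -/
def cubeImage {d D : ℕ} {K : Set (EuclideanSpace ℝ (Fin D))} (f : unitCube d ≃ₜ K)
    (B : Set (EuclideanSpace ℝ (Fin d))) : Set (EuclideanSpace ℝ (Fin D)) :=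
  {y | ∃ x : unitCube d, (x : EuclideanSpace ℝ (Fin d)) ∈ B ∧
    (f x : EuclideanSpace ℝ (Fin D)) = y}

/-- The measure `P` on `ℝ^D` is carried by a compact set `K` that is the image of `[0,1]^d` under
a Lipschitz homeomorphism `f`; there is a constant `c > 0` with `P (f(B)) ≥ c * λ(B)` for every
measurable `B ⊆ [0,1]^d`; and, if `d > 0`, the measure `(f⁻¹)_# P` on `[0,1]^d` gives mass zero to
the boundary of the cube. -/
def SatisfiesLowerBound (d : ℕ) {D : ℕ} (P : Measure (EuclideanSpace ℝ (Fin D))) : Prop :=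
  ∃ K : Set (EuclideanSpace ℝ (Fin D)), IsCompact K ∧ P Kᶜ = 0 ∧
    ∃ c : ℝ≥0, 0 < c ∧ ∃ f : unitCube d ≃ₜ K, (∃ L : ℝ≥0, LipschitzWith L f) ∧
      (∀ B : Set (EuclideanSpace ℝ (Fin d)), MeasurableSet B → B ⊆ unitCube d →
        (c : ℝ≥0∞) * volume B ≤ P (cubeImage f B)) ∧
      (0 < d → P (cubeImage f (frontier (unitCube d))) = 0)

/-!
Let `f` be the given homeomorphism of the cube onto `K`, and let `G : [0,1] → [0,1]^d` be a
space-filling curve that is `1/d`-Hölder and satisfies `G_# λ ≤ C λ`. Then `g = f ∘ G` is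
`1/d`-Hölder, has range `K`, and the lower bound on `P` turns into `(c / C) g_# λ ≤ P`. It remains
to slow `g` down so that its image measure becomes `P`.

*Change of time* (`exists_lipschitzWith_map_comp_eq`). Suppose `c g_# λ ≤ P` and `P` is carried by
the range of `g`. The difference `R = P - c g_# λ` is a measure, and the first hitting time
`s x = min g⁻¹{x}` is a Borel section of `g`, so `μ = c λ + s_# R` is a probability measure on
`[0,1]` with `g_# μ = P`. Because `μ ≥ c λ`, its quantile function `φ` is `c⁻¹`-Lipschitz
(`exists_lipschitzWith_map_volume_eq`), and `φ_# λ = μ`. Hence `g ∘ φ` has image measure `P` and the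
same Hölder exponent as `g`. At an atom of `P` the new curve
merely waits.

*The space-filling curve* (`exists_cube_filling_curve`). Put `r = 3^(-1/d)`. The box `∏ i, [0, rⁱ]`
is cut across its longest side into three boxes similar to it with ratio `r`, and the similarities
can be chosen so that the images of the main diagonal are joined end to end. The Banach fixed point
theorem gives a curve whose thirds are the images of the whole curve under these similarities
(`exists_selfSimilar_curve`), and `dist_selfSimilar_le` bounds its oscillation at scale `3⁻ⁿ` by
`2 rⁿ`, which is Hölder continuity with exponent `1/d`. The image of Lebesgue measure under the
curve and the normalized Lebesgue measure of the box are both self-similar under the three maps.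
Such a probability measure on the box is unique (`selfSimilar_measure_unique`), because each
application of the self-similarity improves the comparison of integrals of Lipschitz functions by
the factor `r`; so the two measures agree. In particular the curve has dense, hence full, range in
the box. A linear map takes the box to the unit cube.
-/

/-! ### Reparametrizing a curve to a prescribed image measure -/

/-- A probability measure `μ ≥ c * volume` on the unit interval is the image of Lebesgue measure
under its quantile function, and the quantile function is `c⁻¹`-Lipschitz because the distribution
function of `μ` increases at rate at least `c`. -/
theorem exists_lipschitzWith_map_volume_eq (μ : Measure unitInterval) [IsProbabilityMeasure μ]
    {c : ℝ≥0} (hc : c ≠ 0) (h : c • volume ≤ μ) :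
    ∃ φ : unitInterval → unitInterval, LipschitzWith c⁻¹ φ ∧ Measure.map φ volume = μ := by
  let F : unitInterval → unitInterval := fun x =>
    ⟨μ.real (Set.Iic x), measureReal_nonneg, measureReal_le_one⟩
  have hFmono : Monotone F := fun x y hxy =>
    Subtype.mk_le_mk.2 (measureReal_mono (Set.Iic_subset_Iic.2 hxy))
  let φ : unitInterval → unitInterval := fun t => sInf {x | t ≤ F x}
  have hFtop : F ⊤ = ⊤ := by
    apply Subtype.ext
    simp [F]
  -- The infimum defining `φ t` is attained, by right continuity of `F`.
  have hmem : ∀ t, t ≤ F (φ t) := by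
    intro t
    rcases eq_or_ne (φ t) ⊤ with htop | htop
    · rw [htop, hFtop]; exact le_top
    have hgt : ∀ x, φ t < x → t ≤ F x := by
      intro x hx
      obtain ⟨y, hy, hyx⟩ := sInf_lt_iff.1 hx
      exact le_trans hy (hFmono hyx.le)
    have hlt : φ t < ⊤ := lt_top_iff_ne_top.2 htop
    have hlim := tendsto_measure_biInter_gt (μ := μ) (s := fun x : unitInterval => Set.Iic x)
      (a := φ t) (fun _ _ => measurableSet_Iic.nullMeasurableSet)
      (fun i j _ hij => Set.Iic_subset_Iic.2 hij) ⟨⊤, hlt, measure_ne_top _ _⟩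
    have hInter : (⋂ r > φ t, Set.Iic r) = Set.Iic (φ t) := by
      ext x
      simp only [Set.mem_iInter, Set.mem_Iic]
      exact ⟨fun hx => le_of_forall_gt_imp_ge_of_dense hx, fun hx r hr => hx.trans hr.le⟩
    rw [hInter] at hlim
    have : (nhdsWithin (φ t) (Set.Ioi (φ t))).NeBot := nhdsGT_neBot_of_exists_gt ⟨⊤, hlt⟩
    have hlim' := (ENNReal.tendsto_toReal (measure_ne_top μ (Set.Iic (φ t)))).comp hlim
    refine Subtype.coe_le_coe.1 (ge_of_tendsto hlim' ?_)
    filter_upwards [self_mem_nhdsWithin] with x hx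
    exact Subtype.coe_le_coe.2 (hgt x hx)
  have hgc : ∀ t x, φ t ≤ x ↔ t ≤ F x := fun t x =>
    ⟨fun hx => (hmem t).trans (hFmono hx), fun hx => sInf_le hx⟩
  have hmono : Monotone φ := fun s t hst => (hgc _ _).2 (hst.trans (hmem t))
  have hmeas : Measurable φ := hmono.measurable
  have hincr : ∀ x y : unitInterval, x ≤ y → (c : ℝ) * (y - x) ≤ F y - F x := by
    intro x y hxy
    have h1 : (c : ℝ) * (y - x) ≤ μ.real (Set.Ioc x y) := by
      have h2 := ENNReal.toReal_mono (measure_ne_top _ _) (h (Set.Ioc x y))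
      have hxy' : (0 : ℝ) ≤ y - x := sub_nonneg.2 (Subtype.coe_le_coe.2 hxy)
      rwa [Measure.smul_apply, unitInterval.volume_Ioc, ENNReal.smul_def, smul_eq_mul,
        ENNReal.toReal_mul, ENNReal.toReal_ofReal hxy', ENNReal.coe_toReal] at h2
    refine h1.trans (le_of_eq ?_)
    have h2 : Set.Ioc x y = Set.Iic y \ Set.Iic x := by
      ext z; simp [and_comm]
    rw [h2, measureReal_sdiff (Set.Iic_subset_Iic.2 hxy) measurableSet_Iic]
  have hc' : (0 : ℝ) < c := NNReal.coe_pos.2 (pos_iff_ne_zero.2 hc)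
  have hlip : ∀ s t : unitInterval, s ≤ t → (φ t : ℝ) - φ s ≤ (c : ℝ)⁻¹ * (t - s) := by
    intro s t hst
    rw [sub_le_iff_le_add]
    refine le_of_forall_lt_imp_le_of_dense fun y hy => ?_
    rcases le_or_gt y (φ s) with hys | hys
    · have : 0 ≤ (c : ℝ)⁻¹ * ((t : ℝ) - s) :=
        mul_nonneg (inv_nonneg.2 hc'.le) (sub_nonneg.2 (Subtype.coe_le_coe.2 hst))
      linarith
    · let y' : unitInterval := ⟨y, (φ s).2.1.trans hys.le, hy.le.trans (φ t).2.2⟩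
      have h1 : F y' < t := not_le.1 fun hle => absurd ((hgc t y').2 hle) (not_le.2 hy)
      have h2 := hincr (φ s) y' hys.le
      have h3 : (s : ℝ) ≤ F (φ s) := hmem s
      have h4 : (F y' : ℝ) < t := h1
      have h5 : (c : ℝ) * (y - φ s) ≤ t - s := by
        change (c : ℝ) * (y - φ s) ≤ F y' - F (φ s) at h2
        linarith
      rw [← sub_le_iff_le_add]
      exact (le_inv_mul_iff₀ hc').2 h5
  refine ⟨φ, ?_, ?_⟩
  · refine LipschitzWith.of_dist_le_mul fun s t => ?_
    wlog hst : s ≤ t generalizing s t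
    · rw [dist_comm, dist_comm s t]; exact this t s (le_of_not_ge hst)
    rw [dist_comm, dist_comm s t, Subtype.dist_eq, Subtype.dist_eq, Real.dist_eq, Real.dist_eq,
      abs_of_nonneg (sub_nonneg.2 (Subtype.coe_le_coe.2 (hmono hst))),
      abs_of_nonneg (sub_nonneg.2 (Subtype.coe_le_coe.2 hst)), NNReal.coe_inv]
    exact hlip s t hst
  · refine (Measure.ext_of_Iic _ _ fun x => ?_).symm
    have : φ ⁻¹' Set.Iic x = Set.Iic (F x) := Set.ext fun t => hgc t x
    rw [Measure.map_apply hmeas measurableSet_Iic, this, unitInterval.volume_Iic]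
    exact (ENNReal.ofReal_toReal (measure_ne_top _ _)).symm

/-- If `c * g_# volume ≤ P` for a curve `g` whose range carries `P`, then a `c⁻¹`-Lipschitz change
of time turns `g` into a curve with image measure `P`. The missing mass `P - c * g_# volume` is
transported back to the interval by the Borel section of `g` that picks the first hitting time of
each point. -/
theorem exists_lipschitzWith_map_comp_eq {X : Type*} [TopologicalSpace X] [T2Space X]
    [MeasurableSpace X] [BorelSpace X] {g : unitInterval → X} (hg : Continuous g)
    (P : Measure X) [IsProbabilityMeasure P] (hP : P (Set.range g)ᶜ = 0)
    {c : ℝ≥0} (hc : c ≠ 0) (h : c • Measure.map g volume ≤ P) :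
    ∃ φ : unitInterval → unitInterval, LipschitzWith c⁻¹ φ ∧
      Measure.map (g ∘ φ) volume = P := by
  let s : X → unitInterval := fun x => sInf (g ⁻¹' {x})
  have hs : ∀ x ∈ Set.range g, g (s x) = x := by
    rintro _ ⟨t, rfl⟩
    exact IsClosed.sInf_mem (s := g ⁻¹' {g t}) ⟨t, rfl⟩ (isClosed_singleton.preimage hg)
  have hsmeas : Measurable s := by
    refine measurable_of_Iic fun a => ?_
    rcases eq_or_ne a ⊤ with rfl | ha
    · simp
    have : s ⁻¹' Set.Iic a = g '' Set.Iic a := by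
      ext x
      constructor
      · intro hx
        have hx : s x ≤ a := hx
        refine ⟨s x, hx, hs x ?_⟩
        by_contra hne
        have : g ⁻¹' {x} = ∅ := Set.preimage_singleton_eq_empty.2 hne
        simp only [s, this, sInf_empty, top_le_iff] at hx
        exact ha hx
      · rintro ⟨t, ht, rfl⟩
        exact (sInf_le (show t ∈ g ⁻¹' {g t} from rfl)).trans ht
    rw [this]
    exact (isClosed_Iic.isCompact.image hg).isClosed.measurableSet
  have hprob : IsProbabilityMeasure (Measure.map g volume) :=
    Measure.isProbabilityMeasure_map hg.aemeasurable
  let R : Measure X := P - c • Measure.map g volume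
  have hR : R + c • Measure.map g volume = P := Measure.sub_add_cancel_of_le h
  have hsec : Measure.map (g ∘ s) R = R := by
    have : g ∘ s =ᵐ[R] id := by
      refine measure_mono_null (fun x hx hmem => hx (hs x hmem)) (t := (Set.range g)ᶜ) ?_
      exact le_antisymm ((Measure.sub_le (Set.range g)ᶜ).trans_eq hP) zero_le
    rw [Measure.map_congr this, Measure.map_id]
  let μ : Measure unitInterval := Measure.map s R + c • volume
  have hμ : Measure.map g μ = P := by
    rw [Measure.map_add _ _ hg.measurable, Measure.map_map hg.measurable hsmeas, hsec,
      Measure.map_smul, hR]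
  have : IsProbabilityMeasure μ := by
    constructor
    rw [← measure_univ (μ := P), ← hμ, Measure.map_apply hg.measurable .univ, Set.preimage_univ]
  obtain ⟨φ, hφ, hmap⟩ := exists_lipschitzWith_map_volume_eq μ hc (Measure.le_add_left le_rfl)
  exact ⟨φ, hφ, by rw [← Measure.map_map hg.measurable hφ.continuous.measurable, hmap, hμ]⟩

/-! ### Self-similar curves generated by three contractions -/

/-- Three contractions `T 0`, `T 1`, `T 2` of a bounded complete space that form a chain from `p` to
`q` (`T k` starts where `T (k - 1)` ends) generate a self-similar curve from `p` to `q`, whose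
`k`-th third is the image of the whole curve under `T k`. -/
theorem exists_selfSimilar_curve {X : Type*} [MetricSpace X] [CompactSpace X]
    (T : Fin 3 → X → X) {r : ℝ≥0} (hr : r < 1) (hT : ∀ k, LipschitzWith r (T k)) {p q : X}
    (γ : Path p q) (h0 : T 0 p = p) (h01 : T 0 q = T 1 p) (h12 : T 1 q = T 2 p) (h2 : T 2 q = q) :
    ∃ H : ℝ → X, Continuous H ∧ H 0 = p ∧ H 1 = q ∧
      ∀ k : Fin 3, ∀ t ∈ Set.Icc (0 : ℝ) 1, H ((t + k) / 3) = T k (H t) := by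
  -- Curves that are constant before time `0` and after time `1`; the curve sought is the fixed
  -- point of the operator `Φ` that concatenates the images of a curve under the three maps.
  let S : Set (BoundedContinuousFunction ℝ X) :=
    {h | (∀ t ≤ 0, h t = p) ∧ ∀ t, 1 ≤ t → h t = q}
  have hSclosed : IsClosed S := by
    have hS : S = (⋂ t : Set.Iic (0 : ℝ), {h : BoundedContinuousFunction ℝ X | h t = p}) ∩
        ⋂ t : Set.Ici (1 : ℝ), {h : BoundedContinuousFunction ℝ X | h t = q} := by
      ext h; simp [S]
    rw [hS]
    exact (isClosed_iInter fun t => isClosed_eq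
      (BoundedContinuousFunction.lipschitz_eval_const _).continuous continuous_const).inter
        (isClosed_iInter fun t => isClosed_eq
          (BoundedContinuousFunction.lipschitz_eval_const _).continuous continuous_const)
  let glue : (ℝ → X) → ℝ → X := fun h t =>
    if t ≤ 1 / 3 then T 0 (h (3 * t)) else if t ≤ 2 / 3 then T 1 (h (3 * t - 1))
      else T 2 (h (3 * t - 2))
  have hcont : ∀ h : S, Continuous (glue h.1) := by
    rintro ⟨h, hp, hq⟩
    have hc := fun k => (hT k).continuous
    refine Continuous.if_le (by fun_prop) (Continuous.if_le (by fun_prop) (by fun_prop)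
      continuous_id continuous_const ?_) continuous_id continuous_const ?_
    · intro t ht
      have ht : t = 2 / 3 := ht
      dsimp only
      rw [hq _ (by linarith), hp _ (by linarith), h12]
    · intro t ht
      have ht : t = 1 / 3 := ht
      dsimp only
      rw [if_pos (by rw [ht]; norm_num), hq _ (by linarith), hp _ (by linarith), h01]
  let Φ : S → S := fun h => ⟨⟨⟨glue h.1, hcont h⟩, Metric.diam (Set.univ : Set X), fun x y =>
      Metric.dist_le_diam_of_mem isCompact_univ.isBounded trivial trivial⟩, by
    obtain ⟨h, hp, hq⟩ := h
    constructor
    · intro t ht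
      change glue h t = p
      simp only [glue]
      rw [if_pos (by linarith), hp _ (by linarith), h0]
    · intro t ht
      change glue h t = q
      simp only [glue]
      rw [if_neg (by linarith), if_neg (by linarith), hq _ (by linarith), h2]⟩
  have hΦ : ContractingWith r Φ := by
    refine ⟨hr, LipschitzWith.of_dist_le_mul fun h₁ h₂ => ?_⟩
    refine (BoundedContinuousFunction.dist_le (by positivity)).2 fun t => ?_
    have key : ∀ k u, dist (T k (h₁.1 u)) (T k (h₂.1 u)) ≤ r * dist h₁ h₂ := fun k u =>
      ((hT k).dist_le_mul _ _).trans
        (mul_le_mul_of_nonneg_left (BoundedContinuousFunction.dist_coe_le_dist u) r.coe_nonneg)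
    change dist (glue h₁.1 t) (glue h₂.1 t) ≤ _
    simp only [glue]
    split_ifs <;> exact key _ _
  have : CompleteSpace S := hSclosed.completeSpace_coe
  let γ' : S := ⟨⟨γ.extend, Metric.diam (Set.univ : Set X), fun x y =>
      Metric.dist_le_diam_of_mem isCompact_univ.isBounded trivial trivial⟩,
    fun t ht => γ.extend_of_le_zero ht, fun t ht => γ.extend_of_one_le ht⟩
  obtain ⟨⟨H, hHp, hHq⟩, hfix, -⟩ := hΦ.exists_fixedPoint γ' (edist_ne_top _ _)
  have hH : ∀ t, glue H t = H t := fun t =>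
    congrArg (fun h : S => h.1 t) hfix
  refine ⟨H, H.continuous, hHp 0 le_rfl, hHq 1 le_rfl, ?_⟩
  intro k t ⟨ht0, ht1⟩
  rw [← hH]
  simp only [glue]
  fin_cases k
  · simp only [Fin.zero_eta, Nat.cast_zero, add_zero]
    rw [if_pos (by linarith), show 3 * (t / 3) = t by ring]
  · simp only [Fin.mk_one, Nat.cast_one]
    rcases ht0.eq_or_lt with rfl | ht0
    · rw [if_pos (by norm_num), hHq _ (by norm_num), hHp 0 le_rfl, h01]
    · rw [if_neg (by linarith), if_pos (by linarith), show 3 * ((t + 1) / 3) - 1 = t by ring]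
  · simp only [Fin.reduceFinMk, Nat.cast_ofNat]
    rw [if_neg (by linarith)]
    rcases ht0.eq_or_lt with rfl | ht0
    · rw [if_pos (by norm_num), hHq _ (by norm_num), hHp 0 le_rfl, h12]
    · rw [if_neg (by linarith), show 3 * ((t + 2) / 3) - 2 = t by ring]

section SelfSimilarCurve

variable {X : Type*} [MetricSpace X] {T : Fin 3 → X → X} {r : ℝ≥0} {H : ℝ → X}

/-- A self-similar curve moves by at most `r ^ n` from its starting point in time `3⁻ⁿ`. -/
theorem dist_selfSimilar_zero_le (hT : ∀ k, LipschitzWith r (T k))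
    (hH : ∀ k : Fin 3, ∀ t ∈ Set.Icc (0 : ℝ) 1, H ((t + k) / 3) = T k (H t))
    (hdiam : ∀ s ∈ Set.Icc (0 : ℝ) 1, ∀ t ∈ Set.Icc (0 : ℝ) 1, dist (H s) (H t) ≤ 1) (n : ℕ) :
    ∀ t ∈ Set.Icc (0 : ℝ) 1, t ≤ (1 / 3) ^ n → dist (H 0) (H t) ≤ r ^ n := by
  induction n with
  | zero => exact fun t ht _ => by simpa using hdiam 0 (by simp) t ht
  | succ n ih =>
    intro t ht hle
    rw [pow_succ] at hle
    have hn : (1 / 3 : ℝ) ^ n ≤ 1 := pow_le_one₀ (by norm_num) (by norm_num)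
    have ht' : 3 * t ∈ Set.Icc (0 : ℝ) 1 := ⟨by linarith [ht.1], by linarith⟩
    have h1 := hH 0 0 (by simp)
    have h2 := hH 0 (3 * t) ht'
    simp only [Fin.val_zero, Nat.cast_zero, add_zero, zero_div] at h1 h2
    rw [mul_div_cancel_left₀ _ (by norm_num)] at h2
    rw [h1, h2, pow_succ']
    exact ((hT 0).dist_le_mul _ _).trans
      (mul_le_mul_of_nonneg_left (ih _ ht' (by linarith)) r.coe_nonneg)

/-- A self-similar curve moves by at most `r ^ n` in the last `3⁻ⁿ` units of time. -/
theorem dist_selfSimilar_one_le (hT : ∀ k, LipschitzWith r (T k))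
    (hH : ∀ k : Fin 3, ∀ t ∈ Set.Icc (0 : ℝ) 1, H ((t + k) / 3) = T k (H t))
    (hdiam : ∀ s ∈ Set.Icc (0 : ℝ) 1, ∀ t ∈ Set.Icc (0 : ℝ) 1, dist (H s) (H t) ≤ 1) (n : ℕ) :
    ∀ t ∈ Set.Icc (0 : ℝ) 1, 1 - t ≤ (1 / 3) ^ n → dist (H t) (H 1) ≤ r ^ n := by
  induction n with
  | zero => exact fun t ht _ => by simpa using hdiam t ht 1 (by simp)
  | succ n ih =>
    intro t ht hle
    rw [pow_succ] at hle
    have hn : (1 / 3 : ℝ) ^ n ≤ 1 := pow_le_one₀ (by norm_num) (by norm_num)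
    have ht' : 3 * t - 2 ∈ Set.Icc (0 : ℝ) 1 := ⟨by linarith, by linarith [ht.2]⟩
    have h1 := hH 2 1 (by simp)
    have h2 := hH 2 (3 * t - 2) ht'
    simp only [Fin.val_two, Nat.cast_ofNat, sub_add_cancel] at h1 h2
    rw [show (1 + 2 : ℝ) / 3 = 1 by norm_num] at h1
    rw [mul_div_cancel_left₀ _ (by norm_num)] at h2
    rw [h1, h2, pow_succ']
    exact ((hT 2).dist_le_mul _ _).trans
      (mul_le_mul_of_nonneg_left (ih _ ht' (by linarith)) r.coe_nonneg)

/-- Modulus of continuity of a self-similar curve at the scales `3⁻ⁿ`. If two times are separated by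
one of the points `1/3`, `2/3`, the bounds at the endpoints apply on both sides of it; otherwise
they lie in the same third and the scale drops by one. -/
theorem dist_selfSimilar_le (hT : ∀ k, LipschitzWith r (T k))
    (hH : ∀ k : Fin 3, ∀ t ∈ Set.Icc (0 : ℝ) 1, H ((t + k) / 3) = T k (H t))
    (hdiam : ∀ s ∈ Set.Icc (0 : ℝ) 1, ∀ t ∈ Set.Icc (0 : ℝ) 1, dist (H s) (H t) ≤ 1) (n : ℕ) :
    ∀ s ∈ Set.Icc (0 : ℝ) 1, ∀ t ∈ Set.Icc (0 : ℝ) 1, |s - t| ≤ (1 / 3) ^ n →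
      dist (H s) (H t) ≤ 2 * r ^ n := by
  induction n with
  | zero => exact fun s hs t ht _ => by linarith [hdiam s hs t ht, pow_zero (r : ℝ)]
  | succ n ih =>
    intro s hs t ht hle
    wlog hst : s ≤ t generalizing s t
    · rw [dist_comm]
      exact this t ht s hs (by rwa [abs_sub_comm]) (le_of_not_ge hst)
    rw [abs_sub_comm, abs_of_nonneg (sub_nonneg.2 hst), pow_succ] at hle
    have hn : (1 / 3 : ℝ) ^ n ≤ 1 := pow_le_one₀ (by norm_num) (by norm_num)
    have same : ∀ k : Fin 3, (k : ℝ) ≤ 3 * s → 3 * t ≤ k + 1 →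
        dist (H s) (H t) ≤ 2 * r ^ (n + 1) := by
      intro k h1 h2
      have hs' : 3 * s - k ∈ Set.Icc (0 : ℝ) 1 := ⟨by linarith, by linarith⟩
      have ht' : 3 * t - k ∈ Set.Icc (0 : ℝ) 1 := ⟨by linarith, by linarith⟩
      have hs3 := hH k _ hs'
      have ht3 := hH k _ ht'
      rw [sub_add_cancel, mul_div_cancel_left₀ _ (by norm_num)] at hs3 ht3
      rw [hs3, ht3]
      refine ((hT k).dist_le_mul _ _).trans ?_
      have := mul_le_mul_of_nonneg_left (ih _ hs' _ ht' (by
        rw [abs_sub_comm, abs_of_nonneg (by linarith)]; linarith)) r.coe_nonneg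
      rw [pow_succ]
      calc _ ≤ _ := this
        _ = _ := by ring
    have adj : ∀ j k : Fin 3, (k : ℝ) = j + 1 → j ≤ 3 * s → 3 * s ≤ k → k ≤ 3 * t →
        3 * t ≤ k + 1 → dist (H s) (H t) ≤ 2 * r ^ (n + 1) := by
      intro j k hjk h1 h2 h3 h4
      have hs' : 3 * s - j ∈ Set.Icc (0 : ℝ) 1 := ⟨by linarith, by linarith⟩
      have ht' : 3 * t - k ∈ Set.Icc (0 : ℝ) 1 := ⟨by linarith, by linarith⟩
      have hs3 := hH j _ hs'
      have ht3 := hH k _ ht'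
      rw [sub_add_cancel, mul_div_cancel_left₀ _ (by norm_num)] at hs3 ht3
      have hmeet : T j (H 1) = T k (H 0) := by
        rw [← hH j 1 (by simp), ← hH k 0 (by simp), hjk]
        congr 1; ring
      have h1 := dist_selfSimilar_one_le hT hH hdiam n _ hs' (by linarith)
      have h2 := dist_selfSimilar_zero_le hT hH hdiam n _ ht' (by linarith)
      have h3 := ((hT j).dist_le_mul _ _).trans (mul_le_mul_of_nonneg_left h1 r.coe_nonneg)
      have h4 := ((hT k).dist_le_mul _ _).trans (mul_le_mul_of_nonneg_left h2 r.coe_nonneg)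
      have h5 := dist_triangle (H s) (T j (H 1)) (H t)
      rw [hmeet, hs3, ht3] at h5
      rw [hmeet] at h3
      rw [hs3, ht3, pow_succ]
      calc _ ≤ _ := h5
        _ ≤ _ := add_le_add h3 h4
        _ = _ := by ring
    obtain ⟨hs0, hs1⟩ := hs
    obtain ⟨ht0, ht1⟩ := ht
    rcases le_total (3 * t) 1 with h | h
    · exact same 0 (by simpa using hs0) (by simpa using h)
    rcases le_total (3 * s) 1 with h' | h'
    · exact adj 0 1 (by simp) (by simpa using hs0) (by simpa using h') (by simpa using h)
        (by push_cast [Fin.val_one]; linarith)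
    rcases le_total (3 * t) 2 with h'' | h''
    · exact same 1 (by simpa using h') (by push_cast [Fin.val_one]; linarith)
    rcases le_total (3 * s) 2 with h3 | h3
    · exact adj 1 2 (by push_cast [Fin.val_one, Fin.val_two]; norm_num) (by simpa using h')
        (by simpa using h3) (by simpa using h'') (by push_cast [Fin.val_two]; linarith)
    · exact same 2 (by simpa using h3) (by push_cast [Fin.val_two]; linarith)

end SelfSimilarCurve

/-! ### Self-similar measures -/

/-- If three maps tile `K` by the pieces `S k`, each scaling `μ` down by the factor `3`, then `μ`
restricted to `K` is three times smaller than the sum of its images. -/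
theorem sum_map_restrict_eq {α : Type*} [MeasurableSpace α] {μ : Measure α} {K : Set α}
    {S : Fin 3 → Set α} {T : Fin 3 → α → α} (hS : ∀ k, MeasurableSet (S k))
    (hdisj : Pairwise (Function.onFun (AEDisjoint μ) S)) (hK : ⋃ k, S k = K)
    (hT : ∀ k, Measurable (T k)) (hmap : ∀ k, Measure.map (T k) μ = (3 : ℝ≥0∞) • μ)
    (hpre : ∀ k, T k ⁻¹' S k = K) :
    ∑ k, Measure.map (T k) (μ.restrict K) = (3 : ℝ≥0∞) • μ.restrict K := by
  have h : ∀ k, Measure.map (T k) (μ.restrict K) = (3 : ℝ≥0∞) • μ.restrict (S k) := by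
    intro k
    rw [← hpre k, ← Measure.restrict_map (hT k) (hS k), hmap, Measure.restrict_smul]
  have hsum : μ.restrict K = ∑ k, μ.restrict (S k) := by
    rw [← hK, Measure.restrict_iUnion_ae hdisj fun k => (hS k).nullMeasurableSet,
      Measure.sum_fintype]
  rw [Finset.sum_congr rfl fun k _ => h k, ← Finset.smul_sum, ← hsum]

/-- Averages of a Lipschitz function against two probability measures on a set of diameter at
most `1` that are self-similar under the same contractions are close, to every order. -/
theorem abs_integral_sub_integral_le {E : Type*} [MetricSpace E] [MeasurableSpace E] [BorelSpace E]
    {T : Fin 3 → E → E} {r : ℝ≥0} (hT : ∀ k, LipschitzWith r (T k)) {K : Set E}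
    (hdiam : ∀ x ∈ K, ∀ y ∈ K, dist x y ≤ 1) {μ ν : Measure E}
    [IsProbabilityMeasure μ] [IsProbabilityMeasure ν] (hμK : ∀ᵐ x ∂μ, x ∈ K)
    (hνK : ∀ᵐ x ∂ν, x ∈ K) (hμ : ∑ k, Measure.map (T k) μ = (3 : ℝ≥0∞) • μ)
    (hν : ∑ k, Measure.map (T k) ν = (3 : ℝ≥0∞) • ν) (n : ℕ) :
    ∀ (L : ℝ≥0) (f : E → ℝ), LipschitzWith L f →
      |∫ x, f x ∂μ - ∫ x, f x ∂ν| ≤ 2 * L * r ^ n := by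
  obtain ⟨x₀, hx₀⟩ := hμK.exists
  have hosc : ∀ (L : ℝ≥0) (f : E → ℝ), LipschitzWith L f → ∀ x ∈ K, ‖f x - f x₀‖ ≤ L := by
    intro L f hf x hx
    rw [← dist_eq_norm]
    exact (hf.dist_le_mul x x₀).trans
      ((mul_le_mul_of_nonneg_left (hdiam x hx x₀ hx₀) L.coe_nonneg).trans_eq (mul_one _))
  have hint : ∀ (ρ : Measure E) [IsProbabilityMeasure ρ], (∀ᵐ x ∂ρ, x ∈ K) → ∀ (L : ℝ≥0)
      (f : E → ℝ), LipschitzWith L f → Integrable f ρ := by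
    intro ρ _ hρ L f hf
    have : Integrable (fun x => f x - f x₀) ρ :=
      Integrable.of_bound (hf.continuous.measurable.sub_const _).aestronglyMeasurable L
        (hρ.mono fun x hx => hosc L f hf x hx)
    exact (this.add (integrable_const (f x₀))).congr
      (Filter.Eventually.of_forall fun x => sub_add_cancel (f x) (f x₀))
  have hself : ∀ (ρ : Measure E) [IsProbabilityMeasure ρ], (∀ᵐ x ∂ρ, x ∈ K) →
      ∑ k, Measure.map (T k) ρ = (3 : ℝ≥0∞) • ρ → ∀ (L : ℝ≥0) (f : E → ℝ), LipschitzWith L f →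
      3 * ∫ x, f x ∂ρ = ∑ k, ∫ x, f (T k x) ∂ρ := by
    intro ρ _ hρ h L f hf
    have h1 : ∀ k, Integrable f (Measure.map (T k) ρ) := fun k =>
      (integrable_map_measure hf.continuous.measurable.aestronglyMeasurable
        (hT k).continuous.measurable.aemeasurable).2 (hint ρ hρ _ _ (hf.comp (hT k)))
    have h2 : ∫ x, f x ∂((3 : ℝ≥0∞) • ρ) = 3 * ∫ x, f x ∂ρ := by
      rw [integral_smul_measure]; simp
    rw [← h2, ← h, integral_finsetSum_measure fun k _ => h1 k]
    exact Finset.sum_congr rfl fun k _ => integral_map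
      (hT k).continuous.measurable.aemeasurable hf.continuous.measurable.aestronglyMeasurable
  induction n with
  | zero =>
    intro L f hf
    have hb : ∀ (ρ : Measure E) [IsProbabilityMeasure ρ], (∀ᵐ x ∂ρ, x ∈ K) →
        |∫ x, f x ∂ρ - f x₀| ≤ L := by
      intro ρ _ hρ
      have h1 : ∫ x, f x ∂ρ - f x₀ = ∫ x, (f x - f x₀) ∂ρ := by
        rw [integral_sub (hint ρ hρ L f hf) (integrable_const _)]; simp
      rw [h1]
      simpa using norm_integral_le_of_norm_le_const (hρ.mono fun x hx => hosc L f hf x hx)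
    have h1 := abs_le.1 (hb μ hμK)
    have h2 := abs_le.1 (hb ν hνK)
    rw [pow_zero, abs_le]
    constructor <;> linarith [h1.1, h1.2, h2.1, h2.2]
  | succ n ih =>
    intro L f hf
    have h1 := hself μ hμK hμ L f hf
    have h2 := hself ν hνK hν L f hf
    have h3 : |3 * ∫ x, f x ∂μ - 3 * ∫ x, f x ∂ν| ≤
        ∑ _k : Fin 3, 2 * ((L : ℝ) * r) * (r : ℝ) ^ n := by
      rw [h1, h2, ← Finset.sum_sub_distrib]
      refine (Finset.abs_sum_le_sum_abs _ _).trans (Finset.sum_le_sum fun k _ => ?_)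
      exact_mod_cast ih (L * r) (fun x => f (T k x)) (hf.comp (hT k))
    rw [← mul_sub, abs_mul, abs_of_pos (by norm_num : (0 : ℝ) < 3), Finset.sum_const,
      Finset.card_univ, Fintype.card_fin, nsmul_eq_mul] at h3
    rw [pow_succ]
    push_cast at h3
    linarith

/-- Uniqueness of the self-similar probability measure carried by a bounded set. -/
theorem selfSimilar_measure_unique {E : Type*} [MetricSpace E] [MeasurableSpace E] [BorelSpace E]
    {T : Fin 3 → E → E} {r : ℝ≥0} (hr : r < 1) (hT : ∀ k, LipschitzWith r (T k)) {K : Set E}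
    (hdiam : ∀ x ∈ K, ∀ y ∈ K, dist x y ≤ 1) {μ ν : Measure E}
    [IsProbabilityMeasure μ] [IsProbabilityMeasure ν] (hμK : ∀ᵐ x ∂μ, x ∈ K)
    (hνK : ∀ᵐ x ∂ν, x ∈ K) (hμ : ∑ k, Measure.map (T k) μ = (3 : ℝ≥0∞) • μ)
    (hν : ∑ k, Measure.map (T k) ν = (3 : ℝ≥0∞) • ν) : μ = ν := by
  have heq : ∀ f : E → ℝ, (∃ L, LipschitzWith L f) → ∫ x, f x ∂μ = ∫ x, f x ∂ν := by
    rintro f ⟨L, hf⟩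
    have h1 : Filter.Tendsto (fun n : ℕ => 2 * (L : ℝ) * r ^ n) Filter.atTop (nhds 0) := by
      simpa using (tendsto_pow_atTop_nhds_zero_of_lt_one r.coe_nonneg
        (by exact_mod_cast hr : (r : ℝ) < 1)).const_mul (2 * (L : ℝ))
    have h2 := ge_of_tendsto' h1 fun n =>
      abs_integral_sub_integral_le hT hdiam hμK hνK hμ hν n L f hf
    exact sub_eq_zero.1 (abs_nonpos_iff.1 h2)
  -- Weak convergence of a constant sequence, tested against Lipschitz functions.
  let μ' : ProbabilityMeasure E := ⟨μ, inferInstance⟩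
  let ν' : ProbabilityMeasure E := ⟨ν, inferInstance⟩
  have hlim : Filter.Tendsto (fun _ : ℕ => μ') Filter.atTop (nhds ν') :=
    tendsto_iff_forall_lipschitz_integral_tendsto.2 fun f _ hf => by
      change Filter.Tendsto (fun _ : ℕ => ∫ x, f x ∂μ) _ (nhds (∫ x, f x ∂ν))
      rw [heq f hf]
      exact tendsto_const_nhds
  exact congrArg (fun ρ : ProbabilityMeasure E => (ρ : Measure E))
    (tendsto_nhds_unique (tendsto_const_nhds (x := μ')) hlim)

/-! ### Scaling of Lebesgue measure -/

/-- A map that permutes the coordinates and acts on each of them by a nondegenerate affine function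
multiplies Lebesgue measure by a constant. -/
theorem map_affine_volume_pi {ι : Type*} [Fintype ι] (σ : Equiv.Perm ι) {a : ι → ℝ}
    (ha : ∀ i, a i ≠ 0) (b : ι → ℝ) :
    Measure.map (fun (z : ι → ℝ) i => a i * z (σ i) + b i) volume =
      ENNReal.ofReal (∏ i, |(a i)⁻¹|) • (volume : Measure (ι → ℝ)) := by
  have hmeas : Measurable fun (z : ι → ℝ) i => a i * z (σ i) + b i := by fun_prop
  have hprod : ENNReal.ofReal (∏ i, |(a i)⁻¹|) = ∏ i, ENNReal.ofReal |(a i)⁻¹| :=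
    ENNReal.ofReal_prod_of_nonneg fun i _ => abs_nonneg _
  have hc : ∏ i, ENNReal.ofReal |(a i)⁻¹| ≠ 0 :=
    Finset.prod_ne_zero_iff.2 fun i _ => by simpa using ha i
  have hc' : ∏ i, ENNReal.ofReal |(a i)⁻¹| ≠ ∞ := by
    rw [← hprod]; exact ENNReal.ofReal_ne_top
  rw [hprod]
  have key : Measure.pi (fun _ : ι => (volume : Measure ℝ)) = (∏ i, ENNReal.ofReal |(a i)⁻¹|)⁻¹ •
      Measure.map (fun (z : ι → ℝ) i => a i * z (σ i) + b i) volume := by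
    refine Measure.pi_eq fun s hs => ?_
    have hpre : (fun (z : ι → ℝ) i => a i * z (σ i) + b i) ⁻¹' Set.univ.pi s =
        Set.univ.pi fun j => (fun x => a (σ.symm j) * x) ⁻¹'
          ((fun x => x + b (σ.symm j)) ⁻¹' s (σ.symm j)) := by
      ext z
      simp only [Set.mem_preimage, Set.mem_univ_pi]
      exact ⟨fun h j => by simpa using h (σ.symm j), fun h i => by simpa using h (σ i)⟩
    rw [Measure.smul_apply, Measure.map_apply hmeas (MeasurableSet.univ_pi hs), hpre, volume_pi_pi]
    have h1 : ∀ j, volume ((fun x => a (σ.symm j) * x) ⁻¹'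
        ((fun x => x + b (σ.symm j)) ⁻¹' s (σ.symm j))) =
        ENNReal.ofReal |(a (σ.symm j))⁻¹| * volume (s (σ.symm j)) := by
      intro j
      rw [Real.volume_preimage_mul_left (ha _), measure_preimage_add_right]
    simp_rw [h1]
    rw [Equiv.prod_comp σ.symm (fun i => ENNReal.ofReal |(a i)⁻¹| * volume (s i)),
      Finset.prod_mul_distrib, smul_eq_mul, ← mul_assoc, ENNReal.inv_mul_cancel hc hc', one_mul]
  rw [← volume_pi] at key
  conv_rhs => rw [key, smul_smul, ENNReal.mul_inv_cancel hc hc', one_smul]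

/-! ### The Peano curve of a box -/

/-- The box `∏ i, [0, rⁱ]`. If `r ^ (n + 1) = 1 / 3`, each of the three boxes into which it is cut
across the coordinate `0` is similar to it with ratio `r`, in the sup metric and up to a cyclic
permutation of the coordinates. -/
def peanoBox (n : ℕ) (r : ℝ≥0) : Set (Fin (n + 1) → ℝ) :=
  {z | ∀ i, 0 ≤ z i ∧ z i ≤ (r : ℝ) ^ (i : ℕ)}

/-- The similarity of `peanoBox n r` onto its `k`-th third across the coordinate `0`. The middle one
reverses all coordinates but the coordinate `0`, so that the images of the main diagonal under the
three maps are joined end to end. -/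
noncomputable def peanoMap (n : ℕ) (r : ℝ≥0) (k : Fin 3) (z : Fin (n + 1) → ℝ)
    (i : Fin (n + 1)) : ℝ :=
  (if k = 1 ∧ i ≠ 0 then -(r : ℝ) else r) * z (Equiv.subRight 1 i) +
    if i = 0 then (k : ℝ) / 3 else if k = 1 then (r : ℝ) ^ (i : ℕ) else 0

/-- The `k`-th third of `peanoBox n r` across the coordinate `0`. -/
def peanoThird (n : ℕ) (r : ℝ≥0) (k : Fin 3) : Set (Fin (n + 1) → ℝ) :=
  {z | z ∈ peanoBox n r ∧ (k : ℝ) / 3 ≤ z 0 ∧ z 0 ≤ k / 3 + 1 / 3}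

section Peano

variable {n : ℕ} {r : ℝ≥0}

theorem peanoBox_eq_pi :
    peanoBox n r = Set.univ.pi fun i : Fin (n + 1) => Set.Icc 0 ((r : ℝ) ^ (i : ℕ)) := by
  ext z; simp only [peanoBox, Set.mem_univ_pi, Set.mem_Icc, Set.mem_ofPred_eq]

theorem isCompact_peanoBox : IsCompact (peanoBox n r) := by
  rw [peanoBox_eq_pi]; exact isCompact_univ_pi fun _ => isCompact_Icc

theorem lipschitzWith_peanoMap (k : Fin 3) : LipschitzWith r (peanoMap n r k) := by
  refine LipschitzWith.of_dist_le_mul fun x y => (dist_pi_le_iff (by positivity)).2 fun i => ?_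
  have h : ∀ a b : ℝ, |a| = r → dist (a * x (Equiv.subRight 1 i) + b)
      (a * y (Equiv.subRight 1 i) + b) ≤ r * dist x y := by
    intro a b ha
    rw [dist_add_right, Real.dist_eq, ← mul_sub, abs_mul, ha, ← Real.dist_eq]
    exact mul_le_mul_of_nonneg_left (dist_le_pi_dist x y _) r.coe_nonneg
  refine h _ _ ?_
  split_ifs <;> simp

theorem mul_pow_subRight (hr : r ^ (n + 1) = 1 / 3) (i : Fin (n + 1)) :
    (r : ℝ) * (r : ℝ) ^ ((Equiv.subRight 1 i : Fin (n + 1)) : ℕ) =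
      if i = 0 then 1 / 3 else (r : ℝ) ^ (i : ℕ) := by
  have hr' : (r : ℝ) ^ (n + 1) = 1 / 3 := by
      simpa using congrArg NNReal.toReal hr
  rw [← pow_succ', Equiv.subRight_apply]
  split_ifs with h
  · have h0 : ((0 - 1 : Fin (n + 1)) : ℕ) = n := by
      cases n <;> simp
    rw [h, h0, hr']
  · rw [Fin.val_sub_one_of_ne_zero h, Nat.sub_add_cancel]
    exact Nat.one_le_iff_ne_zero.2 fun h' => h (Fin.ext h')

theorem peanoMap_zero_apply (k : Fin 3) (i : Fin (n + 1)) : peanoMap n r k 0 i =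
    if i = 0 then (k : ℝ) / 3 else if k = 1 then (r : ℝ) ^ (i : ℕ) else 0 := by
  simp [peanoMap]

theorem peanoMap_diagonal_apply (hr : r ^ (n + 1) = 1 / 3) (k : Fin 3) (i : Fin (n + 1)) :
    peanoMap n r k (fun j => (r : ℝ) ^ (j : ℕ)) i =
      if i = 0 then (k : ℝ) / 3 + 1 / 3 else if k = 1 then 0 else (r : ℝ) ^ (i : ℕ) := by
  have h := mul_pow_subRight hr i
  unfold peanoMap
  split_ifs with h1 <;> simp_all
  linarith

theorem pos_of_pow_eq_third (hr : r ^ (n + 1) = 1 / 3) : 0 < r := by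
  rw [pos_iff_ne_zero]
  rintro rfl
  simp at hr

theorem lt_one_of_pow_eq_third (hr : r ^ (n + 1) = 1 / 3) : r < 1 := by
  by_contra! h
  have h1 := one_le_pow₀ h (n := n + 1)
  rw [hr] at h1
  have : (1 : ℝ) ≤ 1 / 3 := by exact_mod_cast h1
  norm_num at this

/-- `peanoMap n r k` carries exactly the box into its `k`-th third: in each coordinate both
conditions say that `r * z (i - 1)` lies between `0` and the side of the third. -/
theorem preimage_peanoThird (hr : r ^ (n + 1) = 1 / 3) (k : Fin 3) :
    peanoMap n r k ⁻¹' peanoThird n r k = peanoBox n r := by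
  have hr0 : (0 : ℝ) < r := NNReal.coe_pos.2 (pos_of_pow_eq_third hr)
  have hk : (0 : ℝ) ≤ k ∧ (k : ℝ) ≤ 2 := by
    fin_cases k <;> norm_num
  ext z
  have hbox : z ∈ peanoBox n r ↔ ∀ i : Fin (n + 1), 0 ≤ r * z (Equiv.subRight 1 i) ∧
      r * z (Equiv.subRight 1 i) ≤ if i = 0 then 1 / 3 else (r : ℝ) ^ (i : ℕ) := by
    simp_rw [← mul_pow_subRight hr, mul_nonneg_iff_of_pos_left hr0, mul_le_mul_iff_right₀ hr0]
    exact ((Equiv.subRight (1 : Fin (n + 1))).forall_congr_right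
      (q := fun i => 0 ≤ z i ∧ z i ≤ (r : ℝ) ^ (i : ℕ))).symm
  have hthird : ∀ y : Fin (n + 1) → ℝ, y ∈ peanoThird n r k ↔
      ∀ i, if i = 0 then (k : ℝ) / 3 ≤ y i ∧ y i ≤ k / 3 + 1 / 3
        else 0 ≤ y i ∧ y i ≤ (r : ℝ) ^ (i : ℕ) := by
    intro y
    constructor
    · rintro ⟨h, h0⟩ i
      split_ifs with hi
      · rw [hi]; exact h0
      · exact h i
    · intro h
      have h0 := h 0
      rw [if_pos rfl] at h0
      refine ⟨fun i => ?_, h0⟩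
      have hi := h i
      split_ifs at hi with hi0
      · rw [hi0, Fin.val_zero, pow_zero]
        exact ⟨by linarith, by linarith⟩
      · exact hi
  rw [Set.mem_preimage, hthird, hbox]
  refine forall_congr' fun i => ?_
  by_cases hi : i = 0
  · simp only [peanoMap, hi, if_true, ne_eq, not_true_eq_false, and_false, if_false]
    constructor <;> rintro ⟨h1, h2⟩ <;> constructor <;> linarith
  · by_cases hk1 : k = 1
    · simp only [peanoMap, hi, hk1, if_true, ne_eq, not_false_eq_true, and_true, if_false]
      constructor <;> rintro ⟨h1, h2⟩ <;> constructor <;> linarith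
    · simp only [peanoMap, hi, hk1, ne_eq, not_false_eq_true, and_true, if_false, add_zero]

theorem mapsTo_peanoMap (hr : r ^ (n + 1) = 1 / 3) (k : Fin 3) :
    Set.MapsTo (peanoMap n r k) (peanoBox n r) (peanoBox n r) := by
  intro z hz
  rw [← preimage_peanoThird hr k] at hz
  exact hz.1

theorem iUnion_peanoThird : ⋃ k, peanoThird n r k = peanoBox n r := by
  refine Set.Subset.antisymm (Set.iUnion_subset fun k z hz => hz.1) fun z hz => ?_
  have h0 := hz 0
  rw [Fin.val_zero, pow_zero] at h0
  rw [Set.mem_iUnion]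
  rcases le_total (z 0) (1 / 3) with h | h
  · exact ⟨0, hz, by simpa using h0.1, by simpa using h⟩
  rcases le_total (z 0) (2 / 3) with h' | h'
  · exact ⟨1, hz, by simpa using h, by push_cast [Fin.val_one]; linarith⟩
  · exact ⟨2, hz, by simpa using h', by push_cast [Fin.val_two]; linarith⟩

/-- Lebesgue measure on the box is self-similar: it is cut into three equal parts. -/
theorem sum_map_peanoMap_volume (hr : r ^ (n + 1) = 1 / 3) :
    ∑ k, Measure.map (peanoMap n r k) (volume.restrict (peanoBox n r)) =
      (3 : ℝ≥0∞) • volume.restrict (peanoBox n r) := by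
  have hr0 : (r : ℝ) ≠ 0 := (NNReal.coe_pos.2 (pos_of_pow_eq_third hr)).ne'
  refine sum_map_restrict_eq (fun k => ?_) ?_ iUnion_peanoThird
    (fun k => (lipschitzWith_peanoMap k).continuous.measurable) (fun k => ?_)
    (preimage_peanoThird hr)
  · refine (isCompact_peanoBox.isClosed.inter ((isClosed_le continuous_const
      (continuous_apply 0)).inter (isClosed_le (continuous_apply 0)
        continuous_const))).measurableSet
  · have key : ∀ j k : Fin 3, j < k →
        AEDisjoint volume (peanoThird n r j) (peanoThird n r k) := by
      intro j k hjk
      refine measure_mono_null (t := {z | z 0 = (k : ℝ) / 3}) (fun z hz => ?_)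
        (Measure.pi_hyperplane (fun _ : Fin (n + 1) => (volume : Measure ℝ)) 0 _)
      have hle : (j : ℝ) + 1 ≤ k := by exact_mod_cast Fin.lt_def.1 hjk
      have h1 := hz.1.2.2
      have h2 := hz.2.2.1
      exact le_antisymm (by linarith) h2
    intro j k hjk
    rcases lt_or_gt_of_ne hjk with h | h
    · exact key j k h
    · exact (key k j h).symm
  · have h := map_affine_volume_pi (Equiv.subRight (1 : Fin (n + 1)))
      (a := fun i => if k = 1 ∧ i ≠ 0 then -(r : ℝ) else r)
      (fun i => by split_ifs <;> simpa using hr0)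
      (fun i => if i = 0 then (k : ℝ) / 3 else if k = 1 then (r : ℝ) ^ (i : ℕ) else 0)
    have habs : ∀ i : Fin (n + 1), |(if k = 1 ∧ i ≠ 0 then -(r : ℝ) else r)⁻¹| = (r : ℝ)⁻¹ := by
      intro i; split_ifs <;> simp [abs_inv]
    have hr' : (r : ℝ) ^ (n + 1) = 1 / 3 := by
      simpa using congrArg NNReal.toReal hr
    simp_rw [habs, Finset.prod_const, Finset.card_univ, Fintype.card_fin, inv_pow, hr'] at h
    refine h.trans ?_
    norm_num

/-- Lebesgue measure on `[0,1]` is self-similar. -/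
theorem sum_map_add_div_three_volume :
    ∑ k : Fin 3, Measure.map (fun t : ℝ => (t + k) / 3) (volume.restrict (Set.Icc 0 1)) =
      (3 : ℝ≥0∞) • volume.restrict (Set.Icc (0 : ℝ) 1) := by
  refine sum_map_restrict_eq (S := fun k => Set.Icc ((k : ℝ) / 3) ((k + 1) / 3))
    (fun k => measurableSet_Icc) ?_ ?_ (fun k => by fun_prop) (fun k => ?_) (fun k => ?_)
  · have key : ∀ j k : Fin 3, j < k → AEDisjoint volume (Set.Icc ((j : ℝ) / 3) ((j + 1) / 3))
        (Set.Icc ((k : ℝ) / 3) ((k + 1) / 3)) := by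
      intro j k hjk
      refine measure_mono_null (t := {(k : ℝ) / 3}) (fun z hz => ?_) Real.volume_singleton
      have hle : (j : ℝ) + 1 ≤ k := by exact_mod_cast Fin.lt_def.1 hjk
      have h1 := hz.1.2
      have h2 := hz.2.1
      exact le_antisymm (by linarith) h2
    intro j k hjk
    rcases lt_or_gt_of_ne hjk with h | h
    · exact key j k h
    · exact (key k j h).symm
  · ext t
    rw [Set.mem_iUnion]
    constructor
    · rintro ⟨k, h1, h2⟩
      have hk : (0 : ℝ) ≤ k ∧ (k : ℝ) ≤ 2 := by
        fin_cases k <;> norm_num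
      exact ⟨by linarith, by linarith⟩
    · rintro ⟨h0, h1⟩
      rcases le_total t (1 / 3) with h | h
      · exact ⟨0, by simpa using h0, by simpa using h⟩
      rcases le_total t (2 / 3) with h' | h'
      · exact ⟨1, by simpa using h, by push_cast [Fin.val_one]; linarith⟩
      · exact ⟨2, by simpa using h', by push_cast [Fin.val_two]; linarith⟩
  · have h1 : (fun t : ℝ => (t + k) / 3) = (fun t => 3⁻¹ * t) ∘ fun t => t + (k : ℝ) := by
      ext t; simp only [Function.comp]; ring
    rw [h1, ← Measure.map_map (by fun_prop) (by fun_prop), map_add_right_eq_self,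
      Real.map_volume_mul_left (by norm_num)]
    norm_num
  · ext t
    simp only [Set.mem_preimage, Set.mem_Icc]
    constructor <;> rintro ⟨h1, h2⟩ <;> constructor <;> linarith

/-- The Peano curve of the box `peanoBox n r`: it fills the box, has Hölder exponent `1 / (n + 1)`
(stated at the scales `3⁻ᵐ`), and carries Lebesgue measure to normalized Lebesgue measure. -/
theorem exists_peano_curve (hr : r ^ (n + 1) = 1 / 3) :
    ∃ H : ℝ → Fin (n + 1) → ℝ, Continuous H ∧ (∀ t, H t ∈ peanoBox n r) ∧
      peanoBox n r ⊆ H '' Set.Icc 0 1 ∧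
      (∀ m : ℕ, ∀ s ∈ Set.Icc (0 : ℝ) 1, ∀ t ∈ Set.Icc (0 : ℝ) 1, |s - t| ≤ (1 / 3) ^ m →
        dist (H s) (H t) ≤ 2 * r ^ m) ∧
      ∃ C : ℝ≥0, C ≠ 0 ∧ Measure.map H (volume.restrict (Set.Icc 0 1)) =
        C • volume.restrict (peanoBox n r) := by
  have hr0 : (0 : ℝ) < r := NNReal.coe_pos.2 (pos_of_pow_eq_third hr)
  have hr1 := lt_one_of_pow_eq_third hr
  have hcompact : CompactSpace (peanoBox n r) := isCompact_iff_compactSpace.1 isCompact_peanoBox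
  -- The endpoints of the curve are the ends of the main diagonal.
  let p : peanoBox n r := ⟨0, fun i => ⟨le_rfl, by simp⟩⟩
  let q : peanoBox n r := ⟨fun i => (r : ℝ) ^ (i : ℕ), fun i => ⟨pow_nonneg hr0.le _, le_rfl⟩⟩
  let γ : Path p q :=
    { toFun := fun t => ⟨fun i => t * (r : ℝ) ^ (i : ℕ), fun i =>
        ⟨mul_nonneg t.2.1 (pow_nonneg hr0.le _),
          mul_le_of_le_one_left (pow_nonneg hr0.le _) t.2.2⟩⟩
      continuous_toFun := by fun_prop
      source' := Subtype.ext (by ext i; simp [p])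
      target' := Subtype.ext (by ext i; simp [q]) }
  let T : Fin 3 → peanoBox n r → peanoBox n r := fun k =>
    (mapsTo_peanoMap hr k).restrict
  have hT : ∀ k, LipschitzWith r (T k) := fun k x y => lipschitzWith_peanoMap k x.1 y.1
  obtain ⟨H, hHc, -, -, hH⟩ := exists_selfSimilar_curve T hr1 hT γ
    (Subtype.ext (funext fun i => (peanoMap_zero_apply 0 i).trans (by simp [p])))
    (Subtype.ext (funext fun i => (peanoMap_diagonal_apply hr 0 i).trans
      (Eq.trans (by simp) (peanoMap_zero_apply 1 i).symm)))
    (Subtype.ext (funext fun i => (peanoMap_diagonal_apply hr 1 i).trans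
      (Eq.trans (by
        have h21 : (2 : Fin 3) ≠ 1 := by decide
        by_cases hi : i = 0 <;> norm_num [hi, h21]) (peanoMap_zero_apply 2 i).symm)))
    (Subtype.ext (funext fun i => (peanoMap_diagonal_apply hr 2 i).trans (by
      by_cases hi : i = 0
      · norm_num [hi, q]
      · simp [hi, q])))
  have hdiam : ∀ x ∈ peanoBox n r, ∀ y ∈ peanoBox n r, dist x y ≤ 1 := by
    intro x hx y hy
    refine (dist_pi_le_iff zero_le_one).2 fun i => ?_
    have h1 : (r : ℝ) ^ (i : ℕ) ≤ 1 := pow_le_one₀ hr0.le (by exact_mod_cast hr1.le)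
    rw [Real.dist_eq, abs_le]
    constructor <;> linarith [hx i, hy i, (hx i).1, (hx i).2, (hy i).1, (hy i).2]
  let G : ℝ → Fin (n + 1) → ℝ := fun t => (H t).1
  have hG : Continuous G := continuous_subtype_val.comp hHc
  have hself : ∀ k : Fin 3, ∀ t ∈ Set.Icc (0 : ℝ) 1, G ((t + k) / 3) = peanoMap n r k (G t) :=
    fun k t ht => congrArg Subtype.val (hH k t ht)
  have hlip := fun k => lipschitzWith_peanoMap (n := n) (r := r) k
  -- Both measures are self-similar under the three maps, hence they coincide up to normalization.
  have hvol0 : volume (peanoBox n r) ≠ 0 := by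
    rw [peanoBox_eq_pi, volume_pi_pi, Finset.prod_ne_zero_iff]
    intro i _
    rw [Real.volume_Icc, sub_zero]
    exact (ENNReal.ofReal_pos.2 (pow_pos hr0 _)).ne'
  have hvolt : volume (peanoBox n r) ≠ ∞ := isCompact_peanoBox.measure_lt_top.ne
  have hmeas : Measure.map G (volume.restrict (Set.Icc 0 1)) =
      (volume (peanoBox n r))⁻¹ • volume.restrict (peanoBox n r) := by
    have hp1 : IsProbabilityMeasure (volume.restrict (Set.Icc (0 : ℝ) 1)) := ⟨by simp⟩
    have hp2 : IsProbabilityMeasure (Measure.map G (volume.restrict (Set.Icc 0 1))) :=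
      Measure.isProbabilityMeasure_map hG.aemeasurable
    have hp3 : IsProbabilityMeasure
        ((volume (peanoBox n r))⁻¹ • volume.restrict (peanoBox n r)) :=
      ⟨by simpa using ENNReal.inv_mul_cancel hvol0 hvolt⟩
    have hbm : MeasurableSet (peanoBox n r) := isCompact_peanoBox.isClosed.measurableSet
    refine selfSimilar_measure_unique hr1 hlip hdiam ?_ ?_ ?_ ?_
    · exact (ae_map_iff hG.aemeasurable hbm).2 (Filter.Eventually.of_forall fun t => (H t).2)
    · exact Measure.ae_smul_measure (ae_restrict_mem hbm) _
    · have h1 : ∀ k : Fin 3, Measure.map (peanoMap n r k)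
          (Measure.map G (volume.restrict (Set.Icc 0 1))) = Measure.map G
            (Measure.map (fun t : ℝ => (t + k) / 3) (volume.restrict (Set.Icc 0 1))) := by
        intro k
        rw [Measure.map_map (hlip k).continuous.measurable hG.measurable,
          Measure.map_map hG.measurable (by fun_prop)]
        refine Measure.map_congr ?_
        filter_upwards [ae_restrict_mem measurableSet_Icc] with t ht
        exact (hself k t ht).symm
      rw [Finset.sum_congr rfl fun k _ => h1 k, ← Measure.map_smul,
        ← sum_map_add_div_three_volume]
      simp only [Fin.sum_univ_three, Measure.map_add _ _ hG.measurable]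
    · simp only [Measure.map_smul, ← Finset.smul_sum, sum_map_peanoMap_volume hr]
      rw [smul_comm]
  -- The range is compact and carries Lebesgue measure on the box, so it is the whole box.
  have hsurj : peanoBox n r ⊆ G '' Set.Icc 0 1 := by
    have hcl : IsClosed (G '' Set.Icc 0 1) := (isCompact_Icc.image hG).isClosed
    have hnull : volume (interior (peanoBox n r) ∩ (G '' Set.Icc 0 1)ᶜ) = 0 := by
      have h1 : Measure.map G (volume.restrict (Set.Icc 0 1)) (G '' Set.Icc 0 1)ᶜ = 0 := by
        rw [Measure.map_apply hG.measurable hcl.isOpen_compl.measurableSet,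
          Measure.restrict_apply (hG.measurable hcl.isOpen_compl.measurableSet)]
        convert measure_empty (μ := (volume : Measure ℝ))
        ext t
        simp only [Set.mem_inter_iff, Set.mem_preimage, Set.mem_compl_iff, Set.mem_empty_iff_false,
          iff_false, not_and]
        exact fun h ht => h (Set.mem_image_of_mem G ht)
      rw [hmeas, Measure.smul_apply, smul_eq_mul, mul_eq_zero,
        Measure.restrict_apply hcl.isOpen_compl.measurableSet] at h1
      rcases h1 with h1 | h1
      · exact absurd h1 (ENNReal.inv_ne_zero.2 hvolt)
      · refine measure_mono_null (fun x hx => ?_) h1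
        exact ⟨hx.2, interior_subset hx.1⟩
    have hempty := (isOpen_interior.inter hcl.isOpen_compl).eq_empty_of_measure_zero hnull
    have hint : interior (peanoBox n r) ⊆ G '' Set.Icc 0 1 := by
      intro x hx
      by_contra hx'
      exact (hempty ▸ (⟨hx, hx'⟩ : x ∈ interior (peanoBox n r) ∩ (G '' Set.Icc 0 1)ᶜ) :
        x ∈ (∅ : Set _))
    refine Set.Subset.trans ?_ (hcl.closure_subset_iff.2 hint)
    rw [peanoBox_eq_pi, interior_pi_set Set.finite_univ, closure_pi_set]
    simp only [interior_Icc]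
    exact Set.pi_mono fun i _ => by rw [closure_Ioo (pow_pos hr0 _).ne]
  refine ⟨G, hG, fun t => (H t).2, hsurj, ?_, (volume (peanoBox n r))⁻¹.toNNReal, ?_, ?_⟩
  · exact dist_selfSimilar_le (H := G) hlip hself
      (fun s _ t _ => hdiam _ (H s).2 _ (H t).2)
  · simp [ENNReal.toNNReal_eq_zero_iff, hvol0, hvolt]
  · rw [hmeas]
    ext A
    simp only [Measure.smul_apply, ENNReal.smul_def, smul_eq_mul]
    rw [ENNReal.coe_toNNReal (ENNReal.inv_ne_top.2 hvol0)]

end Peano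

/-! ### The Peano curve of the unit cube -/

/-- If `f` oscillates by at most `2 * r ^ m` at scale `3⁻ᵐ`, where `r ^ (n + 1) = 1 / 3`, then it is
Hölder continuous with exponent `1 / (n + 1)`. -/
theorem holderWith_of_dist_le_pow {Y : Type*} [PseudoMetricSpace Y] {f : unitInterval → Y} {n : ℕ}
    {r : ℝ≥0} (hr : r ^ (n + 1) = 1 / 3)
    (h : ∀ (m : ℕ) (s t : unitInterval), dist s t ≤ (1 / 3) ^ m → dist (f s) (f t) ≤ 2 * r ^ m) :
    HolderWith (2 * r⁻¹) (1 / ((n + 1 : ℕ) : ℝ≥0)) f := by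
  intro s t
  rcases eq_or_ne s t with rfl | hst
  · simp
  have hr0 : 0 < r := pos_of_pow_eq_third hr
  have hd : 0 < dist s t := dist_pos.2 hst
  have hd1 : dist s t ≤ 1 := by
    rw [Subtype.dist_eq]
    exact Real.dist_le_of_mem_Icc_01 s.2 t.2
  obtain ⟨m, hm1, hm2⟩ := exists_nat_pow_near_of_lt_one hd hd1
    (by norm_num : (0 : ℝ) < 1 / 3) (by norm_num)
  have hr' : (1 / 3 : ℝ) = (r : ℝ) ^ (n + 1) := by
    simpa using (congrArg NNReal.toReal hr).symm
  have hpow : (r : ℝ) ^ (m + 1) ≤ dist s t ^ (((n + 1 : ℕ) : ℝ)⁻¹) := by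
    rw [hr', pow_right_comm] at hm1
    have h1 := Real.rpow_le_rpow (by positivity) hm1.le
      (by positivity : (0 : ℝ) ≤ ((n + 1 : ℕ) : ℝ)⁻¹)
    rwa [Real.pow_rpow_inv_natCast (by positivity) n.succ_ne_zero] at h1
  have hreal : dist (f s) (f t) ≤ 2 * (r : ℝ)⁻¹ * dist s t ^ (((n + 1 : ℕ) : ℝ)⁻¹) := by
    have hr0' : (0 : ℝ) < r := NNReal.coe_pos.2 hr0
    calc dist (f s) (f t) ≤ 2 * (r : ℝ) ^ m := h m s t hm2
      _ = 2 * (r : ℝ)⁻¹ * (r : ℝ) ^ (m + 1) := by rw [pow_succ]; field_simp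
      _ ≤ _ := mul_le_mul_of_nonneg_left hpow (by positivity)
  have hexp : (((1 / ((n + 1 : ℕ) : ℝ≥0) : ℝ≥0)) : ℝ) = (((n + 1 : ℕ) : ℝ)⁻¹) := by
    simp
  rw [hexp, edist_nndist, edist_nndist,
    ← ENNReal.coe_rpow_of_nonneg _ (by positivity : (0 : ℝ) ≤ ((n + 1 : ℕ) : ℝ)⁻¹),
    ← ENNReal.coe_mul, ENNReal.coe_le_coe, ← NNReal.coe_le_coe]
  simpa using hreal

/-- A space-filling curve of the unit cube with the optimal Hölder exponent `1 / d`, whose image of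
Lebesgue measure is dominated by a multiple of Lebesgue measure. -/
theorem exists_cube_filling_curve (d : ℕ) :
    ∃ G : unitInterval → EuclideanSpace ℝ (Fin d), Continuous G ∧ Set.range G = unitCube d ∧
      (∃ C : ℝ≥0, C ≠ 0 ∧ Measure.map G volume ≤ C • volume) ∧
      (1 ≤ d → ∃ C : ℝ≥0, HolderWith C (1 / (d : ℝ≥0)) G) := by
  rcases d with _ | n
  · refine ⟨fun _ => 0, continuous_const, ?_, ⟨1, one_ne_zero, ?_⟩, fun h => absurd h (by simp)⟩
    · ext x
      simp [unitCube, Subsingleton.elim 0 x]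
    · rw [Measure.map_const, measure_univ, one_smul, one_smul, volume_euclideanSpace_eq_dirac]
  obtain ⟨r, hr⟩ : ∃ r : ℝ≥0, r ^ (n + 1) = 1 / 3 :=
    ⟨(1 / 3 : ℝ≥0) ^ (((n + 1 : ℕ) : ℝ)⁻¹), NNReal.rpow_inv_natCast_pow _ n.succ_ne_zero⟩
  have hr0 : (0 : ℝ) < r := NNReal.coe_pos.2 (pos_of_pow_eq_third hr)
  obtain ⟨H, hH, hbox, hsurj, hmod, C, hC, hmap⟩ := exists_peano_curve hr
  have hwpos : ∀ i : Fin (n + 1), (0 : ℝ) < (r : ℝ) ^ (i : ℕ) := fun i => pow_pos hr0 _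
  -- The linear rescaling of the box to the unit cube.
  let A : (Fin (n + 1) → ℝ) → Fin (n + 1) → ℝ := fun z i => ((r : ℝ) ^ (i : ℕ))⁻¹ * z i
  let Ulin : (Fin (n + 1) → ℝ) →L[ℝ] EuclideanSpace ℝ (Fin (n + 1)) :=
    (EuclideanSpace.equiv (Fin (n + 1)) ℝ).symm.toContinuousLinearMap.comp
      (ContinuousLinearMap.pi fun i => ((r : ℝ) ^ (i : ℕ))⁻¹ • ContinuousLinearMap.proj i)
  have hU : ⇑Ulin = (WithLp.toLp 2) ∘ A := rfl
  have hUi : ∀ z i, Ulin z i = ((r : ℝ) ^ (i : ℕ))⁻¹ * z i := fun z i => rfl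
  have hAmeas : Measurable A := by fun_prop
  have hUmap : Measure.map Ulin volume =
      (∏ i : Fin (n + 1), |((r : ℝ) ^ (i : ℕ))⁻¹⁻¹|).toNNReal • volume := by
    have h := map_affine_volume_pi (Equiv.refl (Fin (n + 1)))
      (a := fun i => ((r : ℝ) ^ (i : ℕ))⁻¹) (fun i => (inv_pos.2 (hwpos i)).ne') 0
    have hA : (fun (z : Fin (n + 1) → ℝ) (i : Fin (n + 1)) =>
        ((r : ℝ) ^ (i : ℕ))⁻¹ * z (Equiv.refl _ i) + (0 : Fin (n + 1) → ℝ) i) = A := by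
      ext z i; simp [A]
    rw [hA] at h
    rw [hU, ← Measure.map_map (PiLp.volume_preserving_toLp _).measurable hAmeas, h,
      Measure.map_smul, (PiLp.volume_preserving_toLp _).map_eq]
    rfl
  have hHI : Continuous fun t : unitInterval => H t := hH.comp continuous_subtype_val
  refine ⟨fun t => Ulin (H t), Ulin.continuous.comp hHI, ?_,
    ⟨C * (∏ i : Fin (n + 1), |((r : ℝ) ^ (i : ℕ))⁻¹⁻¹|).toNNReal, ?_, ?_⟩, fun _ => ?_⟩
  · ext x
    constructor
    · rintro ⟨t, rfl⟩ i
      rw [hUi, ← div_eq_inv_mul]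
      exact ⟨div_nonneg (hbox t i).1 (hwpos i).le, (div_le_one (hwpos i)).2 (hbox t i).2⟩
    · intro hx
      obtain ⟨t, ht, htx⟩ := hsurj (show
        (fun i : Fin (n + 1) => (r : ℝ) ^ (i : ℕ) * x i) ∈ peanoBox n r from fun i =>
          ⟨mul_nonneg (hwpos i).le (hx i).1, mul_le_of_le_one_right (hwpos i).le (hx i).2⟩)
      refine ⟨⟨t, ht⟩, ?_⟩
      ext i
      rw [hUi, htx, inv_mul_cancel_left₀ (hwpos i).ne']
  · refine mul_ne_zero hC (Real.toNNReal_pos.2 ?_).ne'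
    exact Finset.prod_pos fun i _ => abs_pos.2 (inv_ne_zero (inv_ne_zero (hwpos i).ne'))
  · have h1 : Measure.map (fun t : unitInterval => Ulin (H t)) volume =
        Measure.map Ulin (Measure.map H (volume.restrict (Set.Icc 0 1))) := by
      rw [← unitInterval.measurePreserving_coe.map_eq,
        Measure.map_map hH.measurable measurable_subtype_coe,
        Measure.map_map Ulin.continuous.measurable (hH.measurable.comp measurable_subtype_coe)]
      rfl
    rw [h1, hmap, Measure.map_smul, mul_smul, ← hUmap]
    gcongr
    · exact Ulin.continuous.measurable
    · exact Measure.restrict_le_self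
  · have h := holderWith_of_dist_le_pow (f := fun t : unitInterval => H t) hr
      (fun m s t hst => hmod m s s.2 t t.2 hst)
    have h2 := (holderWith_one.2 Ulin.lipschitz).comp h
    rw [one_mul] at h2
    exact ⟨_, h2⟩

/-! ### The curve with the prescribed image measure -/

theorem unitInterval.volume_pos_of_isOpen {U : Set unitInterval} (hU : IsOpen U)
    (hne : U.Nonempty) : 0 < volume U := by
  obtain ⟨O, hO, rfl⟩ := isOpen_induced_iff.1 hU
  obtain ⟨t, ht⟩ := hne
  have ht' : (t : ℝ) ∈ closure (Set.Ioo (0 : ℝ) 1) := by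
    rw [closure_Ioo zero_ne_one]; exact t.2
  have hpos : 0 < volume (O ∩ Set.Ioo (0 : ℝ) 1) :=
    (hO.inter isOpen_Ioo).measure_pos _ (mem_closure_iff.1 ht' O hO ht)
  rw [unitInterval.volume_apply]
  exact hpos.trans_le (measure_mono fun x hx => ⟨⟨x, hx.2.1.le, hx.2.2.le⟩, hx.1, rfl⟩)

/-- If `c * g_# volume ≤ P` with `c > 0`, then the curve `g` stays in the support of `P`. -/
theorem range_subset_support_of_smul_map_le {X : Type*} [TopologicalSpace X] [MeasurableSpace X]
    [BorelSpace X] {g : unitInterval → X} (hg : Continuous g) {P : Measure X} {c : ℝ≥0}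
    (hc : c ≠ 0) (h : c • Measure.map g volume ≤ P) : Set.range g ⊆ P.support := by
  rintro _ ⟨t, rfl⟩
  rw [Measure.mem_support_iff_forall]
  intro U hU
  obtain ⟨V, hVU, hV, htV⟩ := mem_nhds_iff.1 hU
  have hpos : 0 < (volume : Measure unitInterval) (g ⁻¹' V) :=
    unitInterval.volume_pos_of_isOpen (hV.preimage hg) ⟨t, htV⟩
  calc 0 < (c : ℝ≥0∞) * volume (g ⁻¹' V) :=
        ENNReal.mul_pos (ENNReal.coe_ne_zero.2 hc) hpos.ne'
    _ = (c • Measure.map g volume) V := by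
        rw [Measure.smul_apply, Measure.map_apply hg.measurable hV.measurableSet, ENNReal.smul_def,
          smul_eq_mul]
    _ ≤ P V := h V
    _ ≤ P U := measure_mono hVU

theorem mainTheorem5 (d D : ℕ) (P : Measure (EuclideanSpace ℝ (Fin D))) [IsProbabilityMeasure P]
    (hP : SatisfiesLowerBound d P) :
    ∃ γ : unitInterval → P.support,
      Continuous γ ∧
      Measure.map (fun t => (γ t : EuclideanSpace ℝ (Fin D))) volume = P ∧
      (1 ≤ d → ∃ C : ℝ≥0, HolderWith C (1 / (d : ℝ≥0)) γ) := by
  obtain ⟨K, -, hPK, c, hc, f, ⟨L, hL⟩, hlow, -⟩ := hP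
  obtain ⟨G, hG, hrange, ⟨C, hC, hmap⟩, hholder⟩ := exists_cube_filling_curve d
  let G' : unitInterval → unitCube d := fun t => ⟨G t, hrange ▸ Set.mem_range_self t⟩
  have hG' : Continuous G' := hG.subtype_mk _
  let g : unitInterval → EuclideanSpace ℝ (Fin D) := fun t => f (G' t)
  have hg : Continuous g := continuous_subtype_val.comp (f.continuous.comp hG')
  have hgK : Set.range g = K := by
    ext y
    constructor
    · rintro ⟨t, rfl⟩; exact (f (G' t)).2
    · intro hy
      obtain ⟨t, ht⟩ : ((f.symm ⟨y, hy⟩ : unitCube d) : EuclideanSpace ℝ (Fin d)) ∈ Set.range G :=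
        hrange.symm ▸ (f.symm ⟨y, hy⟩).2
      have hGt : G' t = f.symm ⟨y, hy⟩ := Subtype.ext ht
      exact ⟨t, by simp only [g, hGt, Homeomorph.apply_symm_apply]⟩
  have hcube : MeasurableSet (unitCube d) := by
    rw [← hrange]; exact (isCompact_range hG).isClosed.measurableSet
  -- The lower bound on `P` is transported from the cube to the space-filling curve of `K`.
  have hle : (c / C) • Measure.map g volume ≤ P := by
    refine Measure.le_iff.2 fun A hA => ?_
    let B : Set (EuclideanSpace ℝ (Fin d)) :=
      Subtype.val '' {x : unitCube d | (f x : EuclideanSpace ℝ (Fin D)) ∈ A}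
    have hB : MeasurableSet B := (MeasurableEmbedding.subtype_coe hcube).measurableSet_image.2
      ((continuous_subtype_val.comp f.continuous).measurable hA)
    have hpre : g ⁻¹' A = G ⁻¹' B := by
      ext t
      constructor
      · exact fun ht => ⟨G' t, ht, rfl⟩
      · rintro ⟨x, hx, hxt⟩
        have : x = G' t := Subtype.ext hxt
        rwa [this] at hx
    have h1 : Measure.map g volume A ≤ C * volume B := by
      rw [Measure.map_apply hg.measurable hA, hpre, ← Measure.map_apply hG.measurable hB]
      exact hmap B
    have h2 : cubeImage f B ⊆ A := by
      rintro _ ⟨x, ⟨y, hy, hyx⟩, rfl⟩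
      exact Subtype.ext hyx ▸ hy
    have hBsub : B ⊆ unitCube d := by
      rintro _ ⟨x, -, rfl⟩; exact x.2
    calc ((c / C) • Measure.map g volume) A = ((c / C : ℝ≥0) : ℝ≥0∞) * Measure.map g volume A := rfl
      _ ≤ ((c / C : ℝ≥0) : ℝ≥0∞) * (C * volume B) := by gcongr
      _ = c * volume B := by
        rw [← mul_assoc, ← ENNReal.coe_mul, div_mul_cancel₀ _ hC]
      _ ≤ P (cubeImage f B) := hlow B hB hBsub
      _ ≤ P A := measure_mono h2
  have hcC : c / C ≠ 0 := div_ne_zero hc.ne' hC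
  obtain ⟨φ, hφ, hφP⟩ := exists_lipschitzWith_map_comp_eq hg P (by rwa [hgK]) hcC hle
  have hsupp : ∀ t, g (φ t) ∈ P.support := fun t =>
    range_subset_support_of_smul_map_le hg hcC hle (Set.mem_range_self _)
  refine ⟨fun t => ⟨g (φ t), hsupp t⟩, (hg.comp hφ.continuous).subtype_mk _, hφP, fun hd => ?_⟩
  obtain ⟨C', hC'⟩ := hholder hd
  have h1 : HolderWith C' (1 / (d : ℝ≥0)) G' := fun s t => hC' s t
  have h2 := ((holderWith_one.2 hL).comp h1).comp (holderWith_one.2 hφ)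
  rw [one_mul, mul_one] at h2
  exact ⟨_, fun s t => h2 s t⟩
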